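/- Let $n,r,m\ge 0$ be integers, let $V=\mathbb{C}^{r+m}$, and let $\mathcal{A}$ be a central arrangement of $n$ hyperplanes $H_1,\dots,H_n$ in $V$, given by linear forms $l_1,\dots,l_n\in V^*$ with $H_i=\{x\in V: l_i(x)=0\}$; repetitions, and loops $l_i=0$ (with $H_i=V$), are allowed. Let $M(\mathcal{A})$ be the matroid on $\{1,\dots,n\}$ whose independent sets are the index sets of linearly independent $l_i$'s, let $r_{\mathcal{A}}$ be its rank function, and assume that $\mathcal{A}$ has rank $r$, i.e. $r_{\mathcal{A}}(\{1,\dots,n\})=r$. Let $$T_{\mathcal{A}}(x,y)=\sum_{S\subseteq\{1,\dots,n\}}(x-1)^{r-r_{\mathcal{A}}(S)}(y-1)^{|S|-r_{\mathcal{A}}(S)}$$ be its Tutte polynomial. For $h\in V$ let $\rho_{\mathcal{A}}(h)$ be the number of indices $i$ with $h\notin H_i$. Let $\mathbb{C}[V]=\mathbb{C}[x_1,\dots,x_{r+m}]$ be the polynomial ring on a basis $x_1,\dots,x_{r+m}$ of $V$, let $\mathbb{C}[V^*]=\mathbb{C}[y_1,\dots,y_{r+m}]$ be the polynomial ring on the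 dual basis, and view each $h\in V$ as a linear form in $\mathbb{C}[V]$. For every integer $k\ge 0$ consider the power ideal $$I_{\mathcal{A},k}=\left\langle h^{\rho_{\mathcal{A}}(h)+k+1} : h\in V,\ h\neq 0\right\rangle\subseteq\mathbb{C}[V]$$ and its inverse system $$C_{\mathcal{A},k}=\left\{g\in\mathbb{C}[V^*] : f(\partial/\partial y_1,\dots,\partial/\partial y_{r+m})\,g=0\ \text{for all } f\in I_{\mathcal{A},k}\right\},$$ which is graded by degree, and let $\mathrm{Hilb}(C_{\mathcal{A},k};q)=\sum_{i\ge 0}\dim_{\mathbb{C}}(C_{\mathcal{A},k})_i\,q^i$. Then, in the ring $\mathbb{Q}((q))[[z]]$ of power series in $z$ over the field of Laurent series in $q$, $$\sum_{k\ge 0}\mathrm{Hilb}(C_{\mathcal{A},k};q)\,z^k=\frac{q^{n-r}}{(1-z)(1-qz)^m}\,T_{\mathcal{A}}\!\left(1+\frac{q}{1-qz},\frac1q\right).$$ In particular, for each $k\ge 0$ the Hilbert series $\mathrm{Hilb}(C_{\mathcal{A},k};q)$ depends only on the matroid $M(\mathcal{A})$ and on $m$: if $\mathcal{B}$ is an arrangement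 of $n'$ hyperplanes of rank $r'$ in $\mathbb{C}^{r'+m}$ and $M(\mathcal{B})$ is isomorphic to $M(\mathcal{A})$, then $\mathrm{Hilb}(C_{\mathcal{A},k};q)=\mathrm{Hilb}(C_{\mathcal{B},k};q)$ for all $k\ge 0$. -/

import Mathlib

open scoped PowerSeries LaurentSeries

noncomputable section

namespace PowerIdeal

/-- The matroid on `Fin n` of a finite family of vectors `l`: a set of indices is independent when
the corresponding (indexed) vectors are linearly independent. -/
def vectorMatroid {n : ℕ} {W : Type*} [AddCommGroup W] [Module ℂ W] (l : Fin n → W) :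
    Matroid (Fin n) :=
  (IndepMatroid.ofFinite (E := Set.univ) Set.finite_univ (fun I => LinearIndepOn ℂ l I)
    (linearIndepOn_empty ℂ l)
    (fun _ _ hJ hIJ => hJ.mono hIJ)
    (by
      intro I J hI hJ hIJ
      by_contra hcon
      push Not at hcon
      have : Fintype I := Fintype.ofFinite I
      have : Fintype J := Fintype.ofFinite J
      have hsub : ∀ e ∈ J, l e ∈ Submodule.span ℂ (l '' I) := by
        intro e he
        by_cases heI : e ∈ I
        · exact Submodule.subset_span ⟨e, heI, rfl⟩
        · by_contra hns
          exact hcon e he heI (hI.insert hns)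
      have h1 : Module.finrank ℂ (Submodule.span ℂ (l '' J)) = J.ncard := by
        have h := finrank_span_eq_card (R := ℂ) (b := fun x : J => l x) hJ
        rw [← Set.image_eq_range] at h
        rw [h, ← Nat.card_eq_fintype_card, Nat.card_coe_set_eq]
      have h2 : Module.finrank ℂ (Submodule.span ℂ (l '' I)) = I.ncard := by
        have h := finrank_span_eq_card (R := ℂ) (b := fun x : I => l x) hI
        rw [← Set.image_eq_range] at h
        rw [h, ← Nat.card_eq_fintype_card, Nat.card_coe_set_eq]
      have hle : Submodule.span ℂ (l '' J) ≤ Submodule.span ℂ (l '' I) := by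
        rw [Submodule.span_le]
        rintro _ ⟨e, he, rfl⟩
        exact hsub e he
      have : FiniteDimensional ℂ (Submodule.span ℂ (l '' I)) :=
        FiniteDimensional.span_of_finite ℂ (Set.toFinite _)
      have h3 := Submodule.finrank_mono hle
      omega)
    (fun I _ => Set.subset_univ I)).matroid

/-- The Tutte polynomial
`T_M(x, y) = ∑_{A ⊆ E} (x - 1)^(r(M) - r(A)) (y - 1)^(|A| - r(A))` of a finite matroid,
as an element of `ℤ[x, y]` with `x = X 0` and `y = X 1`. -/
def tuttePoly {α : Type*} [Finite α] (M : Matroid α) : MvPolynomial (Fin 2) ℤ :=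
  ∑ A ∈ (Set.toFinite M.E).toFinset.powerset,
    (MvPolynomial.X 0 - 1) ^ (M.eRank.toNat - (M.eRk (A : Set α)).toNat) *
      (MvPolynomial.X 1 - 1) ^ (A.card - (M.eRk (A : Set α)).toNat)

/-- A central arrangement of `n` hyperplanes in `ℂ^d`, given by its defining linear forms
`l i`, the `i`-th hyperplane being `{x | l i x = 0}`. Repetitions and zero forms (loops) are
allowed. -/
abbrev Arrangement (n d : ℕ) : Type := Fin n → Module.Dual ℂ (Fin d → ℂ)

/-- The matroid of the arrangement. -/
def Arrangement.matroid {n d : ℕ} (A : Arrangement n d) : Matroid (Fin n) :=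
  vectorMatroid A

/-- `ρ_A(h)`: the number of hyperplanes of `A` that do not contain `h`. -/
def Arrangement.rho {n d : ℕ} (A : Arrangement n d) (h : Fin d → ℂ) : ℕ :=
  {i : Fin n | A i h ≠ 0}.ncard

/-- A vector `h` of `V = ℂ^d`, seen as the linear form `∑ h_i x_i` of the polynomial ring `ℂ[V]`
(whose variables `x_i` are the standard basis of `V`). -/
def linForm {d : ℕ} (h : Fin d → ℂ) : MvPolynomial (Fin d) ℂ :=
  ∑ i, MvPolynomial.C (h i) * MvPolynomial.X i

/-- The power ideal `I_{A,k} = ⟨h^(ρ_A(h) + k + 1) | h ∈ V, h ≠ 0⟩` of `ℂ[V]`. -/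
def Arrangement.powerIdeal {n d : ℕ} (A : Arrangement n d) (k : ℕ) :
    Ideal (MvPolynomial (Fin d) ℂ) :=
  Ideal.span {p | ∃ h : Fin d → ℂ, h ≠ 0 ∧ p = linForm h ^ (A.rho h + k + 1)}

/-- The differential operator `f(∂/∂y_1, …, ∂/∂y_d)` on `ℂ[V*] = ℂ[y_1, …, y_d]`. -/
def diffOp {d : ℕ} (f : MvPolynomial (Fin d) ℂ) : Module.End ℂ (MvPolynomial (Fin d) ℂ) :=
  ∑ s ∈ f.support, f.coeff s •
    (List.ofFn fun i : Fin d =>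
      ((MvPolynomial.pderiv i).toLinearMap : Module.End ℂ (MvPolynomial (Fin d) ℂ)) ^ s i).prod

/-- The inverse system of an ideal `I` of `ℂ[V]`: the `g ∈ ℂ[V*]` with `f(∂/∂y) g = 0` for all
`f ∈ I`. -/
def inverseSystem {d : ℕ} (I : Ideal (MvPolynomial (Fin d) ℂ)) :
    Submodule ℂ (MvPolynomial (Fin d) ℂ) :=
  ⨅ f ∈ I, LinearMap.ker (diffOp f)

/-- `C_{A,k}`: the inverse system of the power ideal `I_{A,k}`. -/
def Arrangement.C {n d : ℕ} (A : Arrangement n d) (k : ℕ) :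
    Submodule ℂ (MvPolynomial (Fin d) ℂ) :=
  inverseSystem (A.powerIdeal k)

/-- The Hilbert series `∑_i dim (S_i) q^i` of a graded space `S` of polynomials, where `S_i` is
the space of the elements of `S` that are homogeneous of degree `i`. -/
def hilb {d : ℕ} (S : Submodule ℂ (MvPolynomial (Fin d) ℂ)) : ℚ⟦X⟧ :=
  PowerSeries.mk fun i =>
    (Module.finrank ℂ ↥(S ⊓ MvPolynomial.homogeneousSubmodule (Fin d) ℂ i) : ℚ)

/-- The variable `q` in the ring `ℚ((q))[[z]]` of power series in `z` over the field of Laurent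
series in `q`. -/
def q : PowerSeries ℚ⸨X⸩ := PowerSeries.C ((PowerSeries.X : ℚ⟦X⟧) : ℚ⸨X⸩)

/-- The variable `z` in `ℚ((q))[[z]]`. -/
def z : PowerSeries ℚ⸨X⸩ := PowerSeries.X

/-- The generating function `∑_{k ≥ 0} Hilb(C_{A,k}; q) z^k` in `ℚ((q))[[z]]`. -/
def Arrangement.hilbGenFun {n d : ℕ} (A : Arrangement n d) : PowerSeries ℚ⸨X⸩ :=
  PowerSeries.mk fun k => ((hilb (A.C k) : ℚ⟦X⟧) : ℚ⸨X⸩)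

end PowerIdeal

end

/-!
The proof is a deletion-restriction argument. A polynomial `g` lies in `C_{A,k}` exactly when, for
every direction `h ≠ 0`, its restriction to the lines in direction `h` has degree at most
`ρ_A(h) + k` (`mem_C_iff`). Let `l` be the first form of the arrangement, and assume `l ≠ 0`. For
the deletion `A'` of the hyperplane `l = 0` and the restriction `A''` of `A'` to it, there is an
exact sequence of graded spaces
`0 → C_{A',k}(-1) → C_{A,k} → C_{A'',k} → 0`,
whose maps are multiplication by `l` and restriction of polynomials (`finrank_C_succ`). Exactness on
the left and in the middle is a count of degrees along lines. Surjectivity is the point that needs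
`k ≥ 0`: restriction to any subspace is surjective on inverse systems (`exists_pullback_eq`), by
induction on the number of hyperplanes. If `l = 0`, removing `l` does not change `C_{A,k}`. For the
empty arrangement, `C_{A,k}` is the space of polynomials of degree at most `k`, because a form of
degree `i` has `i`-th derivative `i! g(h)` in direction `h` (`eq_zero_of_mem_C_empty`).

Expanding the Tutte polynomial over subsets, the right-hand side of the theorem becomes
`(1 - z)⁻¹ ∑_S q^(n - |S|) (1 - q)^(|S| - rk S) (1 - qz)^(rk S - dim V)`, in which the rank of the
arrangement no longer occurs (`subsetSum_eq_tuttePoly`). Splitting the sum according to whether `S`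
contains the first index shows that it obeys the recursion of the exact sequence
(`subsetSum_of_ne_zero`, `subsetSum_of_eq_zero`), so both sides agree by induction
(`hilbGenFun_eq_subsetSum`).
-/

namespace PowerIdeal

open MvPolynomial Module

/-! ### Directional derivatives and inverse systems -/

section DirDeriv

variable {d : ℕ}

/-- The derivative `∑ h_i ∂/∂y_i` of polynomial functions in the direction `h`. -/
noncomputable def dirDeriv (h : Fin d → ℂ) :
    Derivation ℂ (MvPolynomial (Fin d) ℂ) (MvPolynomial (Fin d) ℂ) :=
  ∑ i, h i • pderiv i

lemma dirDeriv_apply (h : Fin d → ℂ) (g : MvPolynomial (Fin d) ℂ) :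
    dirDeriv h g = ∑ i, h i • pderiv i g := by
  rw [dirDeriv, ← Derivation.coeFnAddMonoidHom_apply, map_sum, Finset.sum_apply]
  rfl

@[simp] lemma dirDeriv_X (h : Fin d → ℂ) (i : Fin d) :
    dirDeriv h (X i) = C (h i) := by
  rw [dirDeriv_apply, Finset.sum_eq_single i]
  · simp [smul_eq_C_mul]
  · intro j _ hj
    simp [pderiv_X_of_ne hj.symm]
  · simp

open scoped IsMulCommutative in
/-- The constant-coefficient differential operators compose like polynomials, because partial
derivatives commute. -/
lemma exists_algHom_eq_diffOp :
    ∃ Φ : MvPolynomial (Fin d) ℂ →ₐ[ℂ] Module.End ℂ (MvPolynomial (Fin d) ℂ),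
      (∀ f, diffOp f = Φ f) ∧ ∀ i, Φ (X i) = (pderiv i).toLinearMap := by
  let s : Set (Module.End ℂ (MvPolynomial (Fin d) ℂ)) :=
    Set.range fun i : Fin d => (pderiv i).toLinearMap
  have hcomm : ∀ a ∈ s, ∀ b ∈ s, a * b = b * a := by
    rintro _ ⟨i, rfl⟩ _ ⟨j, rfl⟩
    have h0 : ⁅pderiv (R := ℂ) i, pderiv (R := ℂ) j⁆ = 0 := by
      refine derivation_ext fun a => ?_
      rw [Derivation.commutator_apply]
      simp [pderiv_X, Pi.single_apply, apply_ite]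
    refine LinearMap.ext fun p => ?_
    have h1 := congrArg (fun D => D p) h0
    simp only [Derivation.commutator_apply, Derivation.zero_apply, sub_eq_zero] at h1
    exact h1
  have : IsMulCommutative (Algebra.adjoin ℂ s) := Algebra.isMulCommutative_adjoin ℂ hcomm
  let x : Fin d → Algebra.adjoin ℂ s := fun i => ⟨(pderiv i).toLinearMap, Algebra.subset_adjoin ⟨i, rfl⟩⟩
  refine ⟨(Algebra.adjoin ℂ s).val.comp (aeval x), fun f => ?_, fun i => ?_⟩
  · rw [AlgHom.comp_apply, aeval_def, eval₂_eq', map_sum, diffOp]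
    refine Finset.sum_congr rfl fun t _ => ?_
    rw [map_mul, AlgHom.commutes, ← Algebra.smul_def]
    congr 1
    rw [← List.prod_ofFn, map_list_prod, List.map_ofFn]
    rfl
  · rw [AlgHom.comp_apply, aeval_X]
    rfl

lemma diffOp_linForm_pow (h : Fin d → ℂ) (N : ℕ) (g : MvPolynomial (Fin d) ℂ) :
    diffOp (linForm h ^ N) g = (dirDeriv h)^[N] g := by
  obtain ⟨Φ, hΦ, hX⟩ := exists_algHom_eq_diffOp (d := d)
  have h1 : Φ (linForm h) = (dirDeriv h).toLinearMap := by
    refine LinearMap.ext fun p => ?_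
    simp only [linForm, map_sum, ← smul_eq_C_mul, map_smul, hX, LinearMap.sum_apply,
      LinearMap.smul_apply]
    exact (dirDeriv_apply h p).symm
  rw [hΦ, map_pow, h1, Module.End.pow_apply]
  rfl

lemma mem_inverseSystem_span {S : Set (MvPolynomial (Fin d) ℂ)} {g : MvPolynomial (Fin d) ℂ} :
    g ∈ inverseSystem (Ideal.span S) ↔ ∀ f ∈ S, diffOp f g = 0 := by
  obtain ⟨Φ, hΦ, -⟩ := exists_algHom_eq_diffOp (d := d)
  simp only [inverseSystem, Submodule.mem_iInf, LinearMap.mem_ker]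
  refine ⟨fun h f hf => h f (Ideal.subset_span hf), fun h f hf => ?_⟩
  rw [hΦ]
  induction hf using Submodule.span_induction with
  | mem f hf => rw [← hΦ]; exact h f hf
  | zero => simp
  | add f₁ f₂ _ _ h₁ h₂ => simp [h₁, h₂]
  | smul a f _ hf => simp [hf]

/-- Membership in `C_{A,k}`: the restriction of the polynomial to each line in direction `h` has
degree at most `ρ_A(h) + k`. -/
lemma mem_C_iff {n : ℕ} {A : Arrangement n d} {k : ℕ} {g : MvPolynomial (Fin d) ℂ} :
    g ∈ A.C k ↔ ∀ h : Fin d → ℂ, h ≠ 0 → (dirDeriv h)^[A.rho h + k + 1] g = 0 := by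
  rw [Arrangement.C, Arrangement.powerIdeal, mem_inverseSystem_span]
  constructor
  · intro H h hh
    rw [← diffOp_linForm_pow]
    exact H _ ⟨h, hh, rfl⟩
  · rintro H _ ⟨h, hh, rfl⟩
    rw [diffOp_linForm_pow]
    exact H h hh

lemma dirDeriv_isHomogeneous (h : Fin d → ℂ) {g : MvPolynomial (Fin d) ℂ} {i : ℕ}
    (hg : g.IsHomogeneous i) : (dirDeriv h g).IsHomogeneous (i - 1) := by
  rw [dirDeriv_apply]
  refine IsHomogeneous.sum _ _ _ fun j _ => ?_
  rw [smul_eq_C_mul]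
  exact (hg.pderiv).C_mul _

/-- The top directional derivative of a form recovers its values, by Euler's identity. -/
lemma iterate_dirDeriv_eq_C (h : Fin d → ℂ) (i : ℕ) {g : MvPolynomial (Fin d) ℂ}
    (hg : g.IsHomogeneous i) : (dirDeriv h)^[i] g = C (i.factorial * eval h g) := by
  induction i generalizing g with
  | zero =>
    rw [← totalDegree_zero_iff_isHomogeneous, totalDegree_eq_zero_iff_eq_C] at hg
    rw [hg]
    simp
  | succ i ih =>
    have h2 := congrArg (eval h) hg.sum_X_mul_pderiv
    have h3 : eval h (dirDeriv h g) = (i + 1) * eval h g := by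
      rw [dirDeriv_apply]
      simpa [smul_eq_C_mul] using h2
    rw [Function.iterate_succ_apply, ih (dirDeriv_isHomogeneous h hg), h3, Nat.factorial_succ]
    push_cast
    ring_nf

lemma iterate_dirDeriv_zero (h : Fin d → ℂ) (N : ℕ) : (dirDeriv h)^[N] 0 = 0 :=
  Function.iterate_fixed (map_zero _) N

lemma iterate_dirDeriv_eq_zero_of_le {h : Fin d → ℂ} {g : MvPolynomial (Fin d) ℂ} {N M : ℕ}
    (hNM : N ≤ M) (hg : (dirDeriv h)^[N] g = 0) : (dirDeriv h)^[M] g = 0 := by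
  obtain ⟨c, rfl⟩ := Nat.exists_eq_add_of_le hNM
  rw [add_comm, Function.iterate_add_apply, hg, iterate_dirDeriv_zero]

lemma iterate_dirDeriv_eq_zero_of_isHomogeneous (h : Fin d → ℂ) {i N : ℕ}
    {g : MvPolynomial (Fin d) ℂ} (hg : g.IsHomogeneous i) (hN : i < N) :
    (dirDeriv h)^[N] g = 0 := by
  refine iterate_dirDeriv_eq_zero_of_le hN ?_
  rw [Function.iterate_succ_apply', iterate_dirDeriv_eq_C h i hg, derivation_C]

end DirDeriv

/-! ### Products with a linear form -/

section LinearForm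

variable {d e : ℕ}

/-- A linear form on `ℂ^d`, as a polynomial in the coordinates. -/
noncomputable def formPoly : Module.Dual ℂ (Fin d → ℂ) →ₗ[ℂ] MvPolynomial (Fin d) ℂ where
  toFun l := ∑ i, C (l (Pi.single i 1)) * X i
  map_add' l l' := by simp [add_mul, Finset.sum_add_distrib]
  map_smul' c l := by simp [Finset.smul_sum, smul_eq_C_mul, mul_assoc]

lemma formPoly_apply (l : Module.Dual ℂ (Fin d → ℂ)) :
    formPoly l = ∑ i, C (l (Pi.single i 1)) * X i := rfl

lemma dual_eq_sum (l : Module.Dual ℂ (Fin d → ℂ)) (h : Fin d → ℂ) :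
    l h = ∑ i, l (Pi.single i 1) * h i := by
  rw [l.pi_apply_eq_sum_univ h]
  refine Finset.sum_congr rfl fun i _ => ?_
  rw [smul_eq_mul, mul_comm]
  congr 2
  ext j
  simp [Pi.single_apply, eq_comm]

lemma formPoly_proj (i : Fin d) : formPoly (LinearMap.proj i) = X i := by
  rw [formPoly_apply, Finset.sum_eq_single i]
  · simp
  · intro j _ hj
    simp [hj.symm]
  · simp

lemma eval_formPoly (l : Module.Dual ℂ (Fin d → ℂ)) (h : Fin d → ℂ) :
    eval h (formPoly l) = l h := by
  simp [formPoly_apply, dual_eq_sum l h]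

@[simp] lemma dirDeriv_formPoly (l : Module.Dual ℂ (Fin d → ℂ)) (h : Fin d → ℂ) :
    dirDeriv h (formPoly l) = C (l h) := by
  rw [dual_eq_sum l h]
  simp [formPoly_apply, map_sum]

lemma formPoly_isHomogeneous (l : Module.Dual ℂ (Fin d → ℂ)) : (formPoly l).IsHomogeneous 1 :=
  IsHomogeneous.sum _ _ _ fun i _ => isHomogeneous_C_mul_X _ i

lemma homogeneousComponent_formPoly_mul (l : Module.Dual ℂ (Fin d → ℂ)) (i : ℕ)
    (p : MvPolynomial (Fin d) ℂ) :
    homogeneousComponent (i + 1) (formPoly l * p) = formPoly l * homogeneousComponent i p := by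
  have h (j : ℕ) : homogeneousComponent (i + 1) (formPoly l * homogeneousComponent j p) =
      if i = j then formPoly l * homogeneousComponent i p else 0 := by
    have hm : (formPoly l * homogeneousComponent j p).IsHomogeneous (j + 1) :=
      add_comm 1 j ▸ (formPoly_isHomogeneous l).mul (homogeneousComponent_isHomogeneous j p)
    rw [homogeneousComponent_of_mem hm]
    by_cases hij : i = j
    · subst hij
      simp
    · rw [if_neg hij, if_neg (by omega)]
  conv_lhs => rw [← sum_homogeneousComponent p, Finset.mul_sum, map_sum]
  simp only [h, Finset.sum_ite_eq, Finset.mem_range]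
  split_ifs with hi
  · rfl
  · rw [homogeneousComponent_eq_zero _ _ (by omega), mul_zero]

lemma formPoly_ne_zero {l : Module.Dual ℂ (Fin d → ℂ)} (hl : l ≠ 0) : formPoly l ≠ 0 := by
  intro h
  refine hl (LinearMap.ext fun x => ?_)
  rw [← eval_formPoly, h]
  simp

lemma iterate_dirDeriv_formPoly_mul (l : Module.Dual ℂ (Fin d → ℂ)) (h : Fin d → ℂ)
    (g : MvPolynomial (Fin d) ℂ) (N : ℕ) :
    (dirDeriv h)^[N + 1] (formPoly l * g) =
      formPoly l * (dirDeriv h)^[N + 1] g + ((N + 1 : ℕ) * l h) • (dirDeriv h)^[N] g := by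
  induction N with
  | zero =>
    simp [Derivation.leibniz, smul_eq_C_mul, mul_comm, add_comm]
  | succ N ih =>
    rw [Function.iterate_succ_apply', ih, map_add, Derivation.leibniz, Derivation.map_smul,
      dirDeriv_formPoly, ← Function.iterate_succ_apply' (dirDeriv h),
      ← Function.iterate_succ_apply' (dirDeriv h)]
    simp only [smul_eq_mul, smul_eq_C_mul]
    push_cast
    simp only [map_mul, map_add, map_one, map_natCast]
    ring

lemma iterate_dirDeriv_formPoly_mul_of_apply_eq_zero {l : Module.Dual ℂ (Fin d → ℂ)}
    {h : Fin d → ℂ} (hl : l h = 0) (g : MvPolynomial (Fin d) ℂ) (N : ℕ) :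
    (dirDeriv h)^[N] (formPoly l * g) = formPoly l * (dirDeriv h)^[N] g := by
  cases N with
  | zero => rfl
  | succ N => simp [iterate_dirDeriv_formPoly_mul, hl]

/-- Division by a linear form which is not constant in direction `h` lowers the degree in
direction `h`. -/
lemma iterate_dirDeriv_eq_zero_of_formPoly_mul {l : Module.Dual ℂ (Fin d → ℂ)}
    {h : Fin d → ℂ} (hl : l h ≠ 0) {g : MvPolynomial (Fin d) ℂ} {i : ℕ}
    (hg : g.IsHomogeneous i) {N : ℕ} (H : (dirDeriv h)^[N + 1] (formPoly l * g) = 0) :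
    (dirDeriv h)^[N] g = 0 := by
  -- Descending induction: if the derivative of order `M + 1` of `g` vanishes,
  -- the Leibniz rule for the product isolates the derivative of order `M`.
  have key : ∀ M, N ≤ M → (dirDeriv h)^[M + 1] g = 0 → (dirDeriv h)^[M] g = 0 := by
    intro M hM h1
    have h2 := iterate_dirDeriv_eq_zero_of_le (Nat.succ_le_succ hM) H
    rw [Nat.succ_eq_add_one, iterate_dirDeriv_formPoly_mul, h1, mul_zero, zero_add] at h2
    refine (smul_eq_zero.1 h2).resolve_left (mul_ne_zero ?_ hl)
    exact_mod_cast Nat.succ_ne_zero M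
  have h3 : ∀ c, (dirDeriv h)^[N + c] g = 0 → (dirDeriv h)^[N] g = 0 := by
    intro c
    induction c with
    | zero => exact id
    | succ c ih => exact fun hc => ih (key _ (Nat.le_add_right _ _) hc)
  exact h3 (i + 1) (iterate_dirDeriv_eq_zero_of_isHomogeneous h hg (by omega))

/-- Pullback of polynomial functions along a linear map. -/
noncomputable def pullback (φ : (Fin e → ℂ) →ₗ[ℂ] (Fin d → ℂ)) :
    MvPolynomial (Fin d) ℂ →ₐ[ℂ] MvPolynomial (Fin e) ℂ :=
  aeval fun i => formPoly (LinearMap.proj i ∘ₗ φ)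

lemma pullback_X (φ : (Fin e → ℂ) →ₗ[ℂ] (Fin d → ℂ)) (i : Fin d) :
    pullback φ (X i) = formPoly (LinearMap.proj i ∘ₗ φ) :=
  aeval_X _ _

lemma pullback_formPoly (φ : (Fin e → ℂ) →ₗ[ℂ] (Fin d → ℂ)) (l : Module.Dual ℂ (Fin d → ℂ)) :
    pullback φ (formPoly l) = formPoly (l ∘ₗ φ) := by
  have h : l ∘ₗ φ = ∑ i, l (Pi.single i 1) • (LinearMap.proj i ∘ₗ φ) := by
    refine LinearMap.ext fun x => ?_
    rw [LinearMap.comp_apply, dual_eq_sum l (φ x)]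
    simp [LinearMap.sum_apply]
  rw [h, formPoly_apply]
  simp [pullback_X, smul_eq_C_mul, ← algebraMap_eq]

lemma pullback_pullback {c : ℕ} (φ : (Fin e → ℂ) →ₗ[ℂ] (Fin d → ℂ))
    (ψ : (Fin c → ℂ) →ₗ[ℂ] (Fin e → ℂ)) (g : MvPolynomial (Fin d) ℂ) :
    pullback ψ (pullback φ g) = pullback (φ ∘ₗ ψ) g := by
  have h : (pullback ψ).comp (pullback φ) = pullback (φ ∘ₗ ψ) := by
    ext1 i
    rw [AlgHom.comp_apply, pullback_X, pullback_X, pullback_formPoly, LinearMap.comp_assoc]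
  exact DFunLike.congr_fun h g

lemma pullback_id (g : MvPolynomial (Fin d) ℂ) : pullback LinearMap.id g = g := by
  have h : pullback (LinearMap.id : (Fin d → ℂ) →ₗ[ℂ] _) = AlgHom.id ℂ _ := by
    ext1 i
    rw [pullback_X, LinearMap.comp_id, formPoly_proj]
    rfl
  exact DFunLike.congr_fun h g

lemma pullback_isHomogeneous (φ : (Fin e → ℂ) →ₗ[ℂ] (Fin d → ℂ)) {g : MvPolynomial (Fin d) ℂ}
    {i : ℕ} (hg : g.IsHomogeneous i) : (pullback φ g).IsHomogeneous i := by
  have := hg.aeval (fun j => formPoly (LinearMap.proj j ∘ₗ φ)) (n := 1)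
    fun j => formPoly_isHomogeneous _
  rwa [one_mul] at this

lemma dirDeriv_pullback (φ : (Fin e → ℂ) →ₗ[ℂ] (Fin d → ℂ)) (h : Fin e → ℂ)
    (g : MvPolynomial (Fin d) ℂ) :
    dirDeriv h (pullback φ g) = pullback φ (dirDeriv (φ h) g) := by
  induction g using MvPolynomial.induction_on with
  | C a => rw [← algebraMap_eq]; simp
  | add p q hp hq => simp [hp, hq]
  | mul_X p i hp =>
    simp only [map_mul, map_add, Derivation.leibniz, hp, smul_eq_mul, pullback_X,
      dirDeriv_formPoly, dirDeriv_X]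
    simp [← algebraMap_eq]

lemma iterate_dirDeriv_pullback (φ : (Fin e → ℂ) →ₗ[ℂ] (Fin d → ℂ)) (h : Fin e → ℂ)
    (g : MvPolynomial (Fin d) ℂ) (N : ℕ) :
    (dirDeriv h)^[N] (pullback φ g) = pullback φ ((dirDeriv (φ h))^[N] g) := by
  induction N with
  | zero => rfl
  | succ N ih => rw [Function.iterate_succ_apply', ih, dirDeriv_pullback,
      Function.iterate_succ_apply']

/-- A polynomial function vanishing on the hyperplane `l = 0`, parametrized by `φ`, is divisible
by `l`. -/
lemma exists_eq_formPoly_mul {l : Module.Dual ℂ (Fin d → ℂ)} (hl : l ≠ 0)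
    {φ : (Fin e → ℂ) →ₗ[ℂ] (Fin d → ℂ)} (hφ : Function.Injective φ)
    (hker : LinearMap.range φ = LinearMap.ker l) {i : ℕ} {g : MvPolynomial (Fin d) ℂ}
    (hg : g.IsHomogeneous (i + 1)) (h0 : pullback φ g = 0) :
    ∃ g' : MvPolynomial (Fin d) ℂ, g'.IsHomogeneous i ∧ g = formPoly l * g' := by
  obtain ⟨v, hv⟩ : ∃ v, l v = 1 := by
    obtain ⟨w, hw⟩ := DFunLike.ne_iff.1 hl
    exact ⟨(l w)⁻¹ • w, by simpa using inv_mul_cancel₀ hw⟩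
  obtain ⟨σ, hσ⟩ := φ.exists_leftInverse_of_injective (LinearMap.ker_eq_bot.2 hφ)
  -- `τ` is a retraction onto the hyperplane which moves each point along `v`.
  let τ : (Fin d → ℂ) →ₗ[ℂ] (Fin d → ℂ) := LinearMap.id - l.smulRight v
  have hτ : φ ∘ₗ σ ∘ₗ τ = τ := by
    refine LinearMap.ext fun x => ?_
    have hx : τ x ∈ LinearMap.range φ := by
      rw [hker]
      simp [τ, hv]
    obtain ⟨y, hy⟩ := hx
    rw [LinearMap.comp_apply, LinearMap.comp_apply, ← hy]
    exact congrArg φ (DFunLike.congr_fun hσ y)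
  have h1 : pullback τ g = 0 := by
    rw [← hτ, ← pullback_pullback, h0, map_zero]
  have h2 : (Ideal.Quotient.mkₐ ℂ (Ideal.span {formPoly l})).comp (pullback τ) =
      Ideal.Quotient.mkₐ ℂ (Ideal.span {formPoly l}) := by
    ext1 j
    rw [AlgHom.comp_apply, pullback_X, Ideal.Quotient.mkₐ_eq_mk, Ideal.Quotient.mk_eq_mk_iff_sub_mem,
      Ideal.mem_span_singleton]
    have : (LinearMap.proj j ∘ₗ τ : Module.Dual ℂ (Fin d → ℂ)) = LinearMap.proj j - v j • l := by
      refine LinearMap.ext fun x => ?_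
      simp [τ, mul_comm]
    rw [this, map_sub, map_smul, formPoly_proj, smul_eq_C_mul]
    exact ⟨-C (v j), by ring⟩
  have h3 := DFunLike.congr_fun h2 g
  rw [AlgHom.comp_apply, h1, map_zero, Ideal.Quotient.mkₐ_eq_mk, eq_comm,
    Ideal.Quotient.eq_zero_iff_mem, Ideal.mem_span_singleton] at h3
  obtain ⟨p, rfl⟩ := h3
  refine ⟨homogeneousComponent i p, homogeneousComponent_isHomogeneous i p, ?_⟩
  rw [← homogeneousComponent_formPoly_mul, homogeneousComponent_eq_self hg]

end LinearForm

end PowerIdeal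

namespace PowerIdeal

open MvPolynomial Module

/-! ### Deletion and restriction for inverse systems -/

section DeletionRestriction

variable {n d e : ℕ}

/-- Deletion of the first hyperplane. -/
def Arrangement.tail (A : Arrangement (n + 1) d) : Arrangement n d := fun i => A i.succ

/-- The arrangement induced on the source of a linear map `φ`; if `φ` parametrizes a subspace,
this is the restriction of the arrangement to that subspace. -/
def Arrangement.restrict (A : Arrangement n d) (φ : (Fin e → ℂ) →ₗ[ℂ] (Fin d → ℂ)) :
    Arrangement n e := fun i => A i ∘ₗ φ

lemma rho_restrict (A : Arrangement n d) (φ : (Fin e → ℂ) →ₗ[ℂ] (Fin d → ℂ)) (h : Fin e → ℂ) :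
    (A.restrict φ).rho h = A.rho (φ h) := rfl

lemma rho_of_apply_eq_zero (A : Arrangement (n + 1) d) {h : Fin d → ℂ} (h0 : A 0 h = 0) :
    A.rho h = A.tail.rho h := by
  classical
  simp only [Arrangement.rho, Set.ncard_eq_toFinset_card', Set.toFinset_ofPred]
  rw [Fin.card_filter_univ_succ, if_neg (not_not.2 h0)]
  rfl

lemma rho_of_apply_ne_zero (A : Arrangement (n + 1) d) {h : Fin d → ℂ} (h0 : A 0 h ≠ 0) :
    A.rho h = A.tail.rho h + 1 := by
  classical
  simp only [Arrangement.rho, Set.ncard_eq_toFinset_card', Set.toFinset_ofPred]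
  rw [Fin.card_filter_univ_succ, if_pos h0]
  rfl

lemma rho_tail_le (A : Arrangement (n + 1) d) (h : Fin d → ℂ) : A.tail.rho h ≤ A.rho h := by
  by_cases h0 : A 0 h = 0
  · rw [rho_of_apply_eq_zero A h0]
  · rw [rho_of_apply_ne_zero A h0]
    exact Nat.le_succ _

lemma C_tail_le (A : Arrangement (n + 1) d) (k : ℕ) : A.tail.C k ≤ A.C k := by
  intro g hg
  rw [mem_C_iff] at hg ⊢
  intro h hh
  have := rho_tail_le A h
  exact iterate_dirDeriv_eq_zero_of_le (by omega) (hg h hh)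

lemma C_eq_tail_of_eq_zero (A : Arrangement (n + 1) d) (h0 : A 0 = 0) (k : ℕ) :
    A.C k = A.tail.C k := by
  ext g
  have h1 (h : Fin d → ℂ) : A.rho h = A.tail.rho h := rho_of_apply_eq_zero A (by simp [h0])
  simp only [mem_C_iff, h1]

lemma formPoly_mul_mem_C (A : Arrangement (n + 1) d) {k : ℕ} {g : MvPolynomial (Fin d) ℂ}
    (hg : g ∈ A.tail.C k) : formPoly (A 0) * g ∈ A.C k := by
  rw [mem_C_iff] at hg ⊢
  intro h hh
  by_cases h0 : A 0 h = 0
  · rw [rho_of_apply_eq_zero A h0, iterate_dirDeriv_formPoly_mul_of_apply_eq_zero h0, hg h hh,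
      mul_zero]
  · rw [rho_of_apply_ne_zero A h0, show A.tail.rho h + 1 + k + 1 = A.tail.rho h + k + 1 + 1 by ring,
      iterate_dirDeriv_formPoly_mul, hg h hh, smul_zero, add_zero,
      iterate_dirDeriv_eq_zero_of_le (Nat.le_succ _) (hg h hh), mul_zero]

lemma mem_C_tail_of_formPoly_mul_mem (A : Arrangement (n + 1) d) (hA : A 0 ≠ 0) {k i : ℕ}
    {g : MvPolynomial (Fin d) ℂ} (hi : g.IsHomogeneous i) (hg : formPoly (A 0) * g ∈ A.C k) :
    g ∈ A.tail.C k := by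
  rw [mem_C_iff] at hg ⊢
  intro h hh
  have h1 := hg h hh
  by_cases h0 : A 0 h = 0
  · rw [rho_of_apply_eq_zero A h0, iterate_dirDeriv_formPoly_mul_of_apply_eq_zero h0] at h1
    exact (mul_eq_zero.1 h1).resolve_left (formPoly_ne_zero hA)
  · rw [rho_of_apply_ne_zero A h0,
      show A.tail.rho h + 1 + k + 1 = A.tail.rho h + k + 1 + 1 by ring] at h1
    exact iterate_dirDeriv_eq_zero_of_formPoly_mul h0 hi h1

lemma pullback_mem_C (A : Arrangement n d) {φ : (Fin e → ℂ) →ₗ[ℂ] (Fin d → ℂ)}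
    (hφ : Function.Injective φ) {k : ℕ} {g : MvPolynomial (Fin d) ℂ} (hg : g ∈ A.C k) :
    pullback φ g ∈ (A.restrict φ).C k := by
  rw [mem_C_iff] at hg ⊢
  intro h hh
  rw [iterate_dirDeriv_pullback, rho_restrict, hg _ ((map_ne_zero_iff φ hφ).2 hh), map_zero]

lemma C_restrict_eq_of_range_le_ker (A : Arrangement (n + 1) d)
    {φ : (Fin e → ℂ) →ₗ[ℂ] (Fin d → ℂ)} (hker : LinearMap.range φ ≤ LinearMap.ker (A 0)) (k : ℕ) :
    (A.restrict φ).C k = (A.tail.restrict φ).C k :=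
  C_eq_tail_of_eq_zero (A.restrict φ) (LinearMap.range_le_ker_iff.1 hker) k

lemma mem_C_of_isHomogeneous (A : Arrangement n d) {k i : ℕ} (hik : i ≤ k)
    {g : MvPolynomial (Fin d) ℂ} (hg : g.IsHomogeneous i) : g ∈ A.C k := by
  rw [mem_C_iff]
  intro h _
  exact iterate_dirDeriv_eq_zero_of_isHomogeneous h hg (by omega)

/-- For the empty arrangement, the inverse system consists of the polynomials of degree at most
`k`. -/
lemma eq_zero_of_mem_C_empty (A : Arrangement 0 d) {k i : ℕ} (hik : k < i)
    {g : MvPolynomial (Fin d) ℂ} (hg : g.IsHomogeneous i) (hC : g ∈ A.C k) : g = 0 := by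
  rw [mem_C_iff] at hC
  refine hg.eq_zero_of_forall_eval_eq_zero fun h => ?_
  by_cases hh : h = 0
  · rw [hh, eval_zero, constantCoeff_eq]
    exact hg.coeff_eq_zero (by simpa using (Nat.zero_lt_of_lt hik).ne)
  · have h1 : A.rho h = 0 := by simp [Arrangement.rho, Set.eq_empty_of_isEmpty]
    have h2 := hC h hh
    rw [h1] at h2
    have h3 := iterate_dirDeriv_eq_zero_of_le (M := i) (by omega) h2
    rw [iterate_dirDeriv_eq_C h i hg, C_eq_zero] at h3
    exact (mul_eq_zero.1 h3).resolve_left (by exact_mod_cast i.factorial_ne_zero)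

lemma exists_parametrization_ker {l : Module.Dual ℂ (Fin d → ℂ)} (hl : l ≠ 0) :
    ∃ (e : ℕ) (φ : (Fin e → ℂ) →ₗ[ℂ] (Fin d → ℂ)), e + 1 = d ∧ Function.Injective φ ∧
      LinearMap.range φ = LinearMap.ker l := by
  let b := Module.finBasis ℂ (LinearMap.ker l)
  refine ⟨_, (LinearMap.ker l).subtype ∘ₗ b.equivFun.symm.toLinearMap, ?_, ?_, ?_⟩
  · have h := Module.Dual.finrank_ker_add_one_of_ne_zero hl
    rwa [Module.finrank_fin_fun] at h
  · rw [LinearMap.coe_comp]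
    exact (Submodule.injective_subtype _).comp b.equivFun.symm.injective
  · rw [LinearMap.range_comp, LinearEquiv.range, Submodule.map_top, Submodule.range_subtype]

/-- Restriction of inverse systems to a subspace is surjective. This is where `k ≥ 0` enters.
The induction on the number of hyperplanes splits a polynomial on the subspace into a part lifted
from a smaller subspace and a multiple of the first linear form. -/
lemma exists_pullback_eq (A : Arrangement n d) {φ : (Fin e → ℂ) →ₗ[ℂ] (Fin d → ℂ)}
    (hφ : Function.Injective φ) {k i : ℕ} {g : MvPolynomial (Fin e) ℂ} (hi : g.IsHomogeneous i)
    (hg : g ∈ (A.restrict φ).C k) :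
    ∃ g' : MvPolynomial (Fin d) ℂ, g'.IsHomogeneous i ∧ g' ∈ A.C k ∧ pullback φ g' = g := by
  induction n generalizing e i with
  | zero =>
    by_cases hik : i ≤ k
    · obtain ⟨σ, hσ⟩ := φ.exists_leftInverse_of_injective (LinearMap.ker_eq_bot.2 hφ)
      have h1 := pullback_isHomogeneous σ hi
      refine ⟨pullback σ g, h1, mem_C_of_isHomogeneous A hik h1, ?_⟩
      rw [pullback_pullback, hσ, pullback_id]
    · refine ⟨0, isHomogeneous_zero _ _ _, zero_mem _, ?_⟩
      rw [map_zero, eq_zero_of_mem_C_empty _ (not_le.1 hik) hi hg]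
  | succ n ih =>
    by_cases h0 : A 0 ∘ₗ φ = 0
    · rw [C_restrict_eq_of_range_le_ker A (LinearMap.range_le_ker_iff.2 h0)] at hg
      obtain ⟨g', h1, h2, h3⟩ := ih A.tail hφ hi hg
      exact ⟨g', h1, C_tail_le A k h2, h3⟩
    · obtain ⟨c, ψ, -, hψ, hker⟩ := exists_parametrization_ker h0
      have h1 : pullback ψ g ∈ (A.tail.restrict (φ ∘ₗ ψ)).C k :=
        C_restrict_eq_of_range_le_ker (A.restrict φ) hker.le k ▸ pullback_mem_C _ hψ hg
      obtain ⟨g₁, hi₁, hg₁, hp₁⟩ := ih A.tail (φ := φ ∘ₗ ψ)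
        (by rw [LinearMap.coe_comp]; exact hφ.comp hψ) (pullback_isHomogeneous ψ hi) h1
      have hC₁ := C_tail_le A k hg₁
      have h2 : pullback ψ (g - pullback φ g₁) = 0 := by
        rw [map_sub, pullback_pullback, hp₁, sub_self]
      have h3 : (g - pullback φ g₁).IsHomogeneous i := hi.sub (pullback_isHomogeneous φ hi₁)
      have h4 : g - pullback φ g₁ ∈ (A.restrict φ).C k := sub_mem hg (pullback_mem_C A hφ hC₁)
      rcases i with _ | i
      · -- A constant vanishing on a nonempty set is zero.
        rw [← totalDegree_zero_iff_isHomogeneous, totalDegree_eq_zero_iff_eq_C] at h3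
        rw [h3, ← algebraMap_eq, AlgHom.commutes, algebraMap_eq, C_eq_zero] at h2
        rw [h2, C_0] at h3
        exact ⟨g₁, hi₁, hC₁, (sub_eq_zero.1 h3).symm⟩
      · obtain ⟨g₂, hi₂, hg₂⟩ := exists_eq_formPoly_mul h0 hψ hker h3 h2
        rw [hg₂] at h4
        obtain ⟨g₃, hi₃, hg₃, hp₃⟩ := ih A.tail hφ hi₂
          (mem_C_tail_of_formPoly_mul_mem (A.restrict φ) h0 hi₂ h4)
        refine ⟨g₁ + formPoly (A 0) * g₃, hi₁.add ?_, add_mem hC₁ (formPoly_mul_mem_C A hg₃), ?_⟩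
        · rw [add_comm i]
          exact (formPoly_isHomogeneous _).mul hi₃
        · rw [map_add, map_mul, pullback_formPoly, hp₃, ← hg₂, add_sub_cancel]

end DeletionRestriction

/-! ### Hilbert series -/

section Hilbert

variable {n d e : ℕ}

instance finiteDimensional_homogeneousSubmodule (i : ℕ) :
    FiniteDimensional ℂ (homogeneousSubmodule (Fin d) ℂ i) :=
  Module.Finite.iff_fg.2 (homogeneousSubmodule_fg (Fin d) ℂ i)

lemma finrank_eq_finrank_map_add_finrank_inf_ker {V W : Type*} [AddCommGroup V] [Module ℂ V]
    [AddCommGroup W] [Module ℂ W] (f : V →ₗ[ℂ] W) (T : Submodule ℂ V) [FiniteDimensional ℂ T] :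
    finrank ℂ T = finrank ℂ (T.map f) + finrank ℂ ↥(T ⊓ LinearMap.ker f) := by
  rw [← (f.domRestrict T).finrank_range_add_finrank_ker, LinearMap.range_domRestrict,
    ← Submodule.finrank_map_subtype_eq, LinearMap.ker_domRestrict, Submodule.map_comap_subtype]

/-- The graded exact sequence: multiplication by the first linear form identifies the inverse
system of the deletion with the kernel of restriction to the first hyperplane. -/
lemma finrank_C_succ (A : Arrangement (n + 1) d) (hA : A 0 ≠ 0)
    {φ : (Fin e → ℂ) →ₗ[ℂ] (Fin d → ℂ)} (hφ : Function.Injective φ)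
    (hker : LinearMap.range φ = LinearMap.ker (A 0)) (k i : ℕ) :
    finrank ℂ ↥(A.C k ⊓ homogeneousSubmodule (Fin d) ℂ (i + 1)) =
      finrank ℂ ↥(A.tail.C k ⊓ homogeneousSubmodule (Fin d) ℂ i) +
      finrank ℂ ↥((A.tail.restrict φ).C k ⊓ homogeneousSubmodule (Fin e) ℂ (i + 1)) := by
  have hfin : FiniteDimensional ℂ ↥(A.C k ⊓ homogeneousSubmodule (Fin d) ℂ (i + 1)) :=
    Submodule.finiteDimensional_inf_right _ _
  have h1 : (A.C k ⊓ homogeneousSubmodule (Fin d) ℂ (i + 1)).map (pullback φ).toLinearMap =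
      (A.tail.restrict φ).C k ⊓ homogeneousSubmodule (Fin e) ℂ (i + 1) := by
    rw [← C_restrict_eq_of_range_le_ker A hker.le]
    ext g
    constructor
    · rintro ⟨g, ⟨h1, h2⟩, rfl⟩
      exact ⟨pullback_mem_C A hφ h1, pullback_isHomogeneous φ h2⟩
    · rintro ⟨h1, h2⟩
      obtain ⟨g', h3, h4, h5⟩ := exists_pullback_eq A hφ h2 h1
      exact ⟨g', ⟨h4, h3⟩, h5⟩
  have h2 : (A.tail.C k ⊓ homogeneousSubmodule (Fin d) ℂ i).map
      (LinearMap.mulLeft ℂ (formPoly (A 0))) =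
      (A.C k ⊓ homogeneousSubmodule (Fin d) ℂ (i + 1)) ⊓
        LinearMap.ker (pullback φ).toLinearMap := by
    ext g
    constructor
    · rintro ⟨g, ⟨h1, h2⟩, rfl⟩
      refine ⟨⟨formPoly_mul_mem_C A h1, ?_⟩, ?_⟩
      · exact add_comm 1 i ▸ (formPoly_isHomogeneous (A 0)).mul h2
      · rw [SetLike.mem_coe, LinearMap.mem_ker, LinearMap.mulLeft_apply,
          AlgHom.toLinearMap_apply, map_mul, pullback_formPoly, LinearMap.range_le_ker_iff.1 hker.le, map_zero, zero_mul]
    · rintro ⟨⟨h1, h2⟩, h3⟩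
      obtain ⟨g', h4, rfl⟩ := exists_eq_formPoly_mul hA hφ hker h2 h3
      exact ⟨g', ⟨mem_C_tail_of_formPoly_mul_mem A hA h4 h1, h4⟩, rfl⟩
  rw [finrank_eq_finrank_map_add_finrank_inf_ker (pullback φ).toLinearMap, h1, ← h2, add_comm,
    ← (Submodule.equivMapOfInjective _ (mul_right_injective₀ (formPoly_ne_zero hA)) _).finrank_eq]

lemma finrank_homogeneousSubmodule (d i : ℕ) :
    finrank ℂ (homogeneousSubmodule (Fin d) ℂ i) = Nat.multichoose d i := by
  have h1 : {s : Fin d →₀ ℕ | s.degree = i} = ((Finset.univ : Finset (Fin d)).finsuppAntidiag i) := by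
    ext s
    simp [Finset.mem_finsuppAntidiag, Finsupp.degree_eq_sum]
  rw [homogeneousSubmodule_eq_finsupp_supported, h1,
    (AddMonoidAlgebra.supportedEquivFinsupp _).finrank_eq, Module.finrank_finsupp_self]
  simp [Finset.card_finsuppAntidiag_nat_eq_multichoose]

lemma finrank_C_zero (A : Arrangement n d) (k : ℕ) :
    finrank ℂ ↥(A.C k ⊓ homogeneousSubmodule (Fin d) ℂ 0) = 1 := by
  rw [inf_eq_right.2, finrank_homogeneousSubmodule, Nat.multichoose_zero_right]
  exact fun g hg => mem_C_of_isHomogeneous A (Nat.zero_le k) hg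

lemma hilb_C_of_ne_zero (A : Arrangement (n + 1) d) (hA : A 0 ≠ 0)
    {φ : (Fin e → ℂ) →ₗ[ℂ] (Fin d → ℂ)} (hφ : Function.Injective φ)
    (hker : LinearMap.range φ = LinearMap.ker (A 0)) (k : ℕ) :
    hilb (A.C k) = PowerSeries.X * hilb (A.tail.C k) + hilb ((A.tail.restrict φ).C k) := by
  ext i
  rcases i with _ | i
  · simp [hilb, finrank_C_zero]
  · rw [map_add, PowerSeries.coeff_succ_X_mul]
    simp [hilb, finrank_C_succ A hA hφ hker]

lemma coeff_hilb_C_empty (A : Arrangement 0 d) (k i : ℕ) :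
    PowerSeries.coeff i (hilb (A.C k)) = if i ≤ k then (Nat.multichoose d i : ℚ) else 0 := by
  rw [hilb, PowerSeries.coeff_mk]
  split_ifs with hik
  · rw [← finrank_homogeneousSubmodule, inf_eq_right.2]
    exact fun g hg => mem_C_of_isHomogeneous A hik hg
  · have h : A.C k ⊓ homogeneousSubmodule (Fin d) ℂ i = ⊥ :=
      (Submodule.eq_bot_iff _).2 fun g hg => eq_zero_of_mem_C_empty A (not_le.1 hik) hg.2 hg.1
    rw [h, finrank_bot, Nat.cast_zero]

end Hilbert

end PowerIdeal

namespace PowerIdeal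

open Module

/-! ### The generating function as a sum over subsets -/

section GeneratingFunction

variable {n d e : ℕ}

lemma constantCoeff_one_sub_q_mul_z : PowerSeries.constantCoeff (1 - q * z) ≠ 0 := by
  simp [z]

lemma q_mul_inv : q * q⁻¹ = 1 := by
  refine PowerSeries.mul_inv_cancel _ ?_
  simp [q]

lemma hilbGenFun_of_eq_zero (A : Arrangement (n + 1) d) (hA : A 0 = 0) :
    A.hilbGenFun = A.tail.hilbGenFun := by
  simp only [Arrangement.hilbGenFun, C_eq_tail_of_eq_zero A hA]

lemma hilbGenFun_of_ne_zero (A : Arrangement (n + 1) d) (hA : A 0 ≠ 0)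
    {φ : (Fin e → ℂ) →ₗ[ℂ] (Fin d → ℂ)} (hφ : Function.Injective φ)
    (hker : LinearMap.range φ = LinearMap.ker (A 0)) :
    A.hilbGenFun = q * A.tail.hilbGenFun + (A.tail.restrict φ).hilbGenFun := by
  refine PowerSeries.ext fun k => ?_
  rw [map_add, q, PowerSeries.coeff_C_mul]
  simp only [Arrangement.hilbGenFun, PowerSeries.coeff_mk]
  rw [hilb_C_of_ne_zero A hA hφ hker, map_add, map_mul]

lemma inv_one_sub_q_mul_z_pow (d : ℕ) :
    ((1 - q * z)⁻¹) ^ d = PowerSeries.mk fun k =>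
      (Nat.multichoose d k : ℚ⸨X⸩) * ((PowerSeries.X : ℚ⟦X⟧) : ℚ⸨X⸩) ^ k := by
  set x : ℚ⸨X⸩ := ((PowerSeries.X : ℚ⟦X⟧) : ℚ⸨X⸩) with hx
  have h1 : (1 - q * z)⁻¹ = PowerSeries.rescale x (PowerSeries.mk 1) := by
    rw [PowerSeries.inv_eq_iff_mul_eq_one constantCoeff_one_sub_q_mul_z]
    have h2 := congrArg (PowerSeries.rescale x)
      (PowerSeries.mk_one_mul_one_sub_eq_one ℚ⸨X⸩)
    rwa [map_mul, map_sub, map_one, PowerSeries.rescale_X] at h2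
  rw [h1, ← map_pow]
  refine PowerSeries.ext fun k => ?_
  rw [PowerSeries.coeff_rescale, PowerSeries.coeff_mk, mul_comm]
  congr 1
  rcases d with _ | d
  · rcases k with _ | k <;> simp [PowerSeries.coeff_one]
  · rw [PowerSeries.mk_one_pow_eq_mk_choose_add, PowerSeries.coeff_mk, Nat.multichoose_eq,
      show d + 1 + k - 1 = d + k by omega, Nat.choose_symm_add]

lemma hilbGenFun_empty (A : Arrangement 0 d) :
    A.hilbGenFun = (1 - z)⁻¹ * ((1 - q * z)⁻¹) ^ d := by
  have hz : PowerSeries.constantCoeff (1 - z) ≠ 0 := by simp [z]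
  rw [mul_comm, PowerSeries.eq_mul_inv_iff_mul_eq hz, inv_one_sub_q_mul_z_pow, mul_sub, mul_one]
  refine PowerSeries.ext fun k => ?_
  rw [map_sub, z, PowerSeries.coeff_mk, Arrangement.hilbGenFun, PowerSeries.coeff_mk]
  rcases k with _ | k
  · have h : hilb (A.C 0) = 1 := by
      ext i
      rw [coeff_hilb_C_empty, PowerSeries.coeff_one]
      rcases i with _ | i <;> simp
    simp [h]
  · have h : hilb (A.C (k + 1)) = hilb (A.C k) +
        (Nat.multichoose d (k + 1) : ℚ⟦X⟧) * PowerSeries.X ^ (k + 1) := by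
      ext i
      rw [map_add, coeff_hilb_C_empty, coeff_hilb_C_empty, ← map_natCast (PowerSeries.C (R := ℚ)),
        PowerSeries.coeff_C_mul, PowerSeries.coeff_X_pow]
      rcases lt_trichotomy i (k + 1) with hi | rfl | hi
      · simp [hi.ne, hi.le, Nat.lt_succ_iff.1 hi]
      · simp
      · simp [hi.ne', hi.not_ge, (Nat.lt_of_succ_lt hi).not_ge]
    rw [PowerSeries.coeff_succ_mul_X, PowerSeries.coeff_mk, h, map_add, map_mul, map_pow,
      map_natCast, add_sub_cancel_left]

/-- The rank of a set of linear forms of an arrangement. -/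
noncomputable def Arrangement.rk (A : Arrangement n d) (S : Finset (Fin n)) : ℕ :=
  finrank ℂ (Submodule.span ℂ (A '' S))

lemma rk_le_card (A : Arrangement n d) (S : Finset (Fin n)) : A.rk S ≤ S.card := by
  classical
  rw [Arrangement.rk, ← Finset.coe_image]
  exact (finrank_span_finset_le_card _).trans Finset.card_image_le

lemma image_map_succ (A : Arrangement (n + 1) d) (S : Finset (Fin n)) :
    A '' (S.map (Fin.succEmb n)) = A.tail '' S := by
  rw [Finset.coe_map, ← Set.image_comp]
  rfl

lemma rk_map_succ (A : Arrangement (n + 1) d) (S : Finset (Fin n)) :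
    A.rk (S.map (Fin.succEmb n)) = A.tail.rk S := by
  rw [Arrangement.rk, image_map_succ]
  rfl

lemma rk_insert_of_eq_zero (A : Arrangement (n + 1) d) (hA : A 0 = 0) (S : Finset (Fin n)) :
    A.rk (insert 0 (S.map (Fin.succEmb n))) = A.tail.rk S := by
  rw [Arrangement.rk, Finset.coe_insert, Set.image_insert_eq, image_map_succ, hA,
    Submodule.span_insert_zero]
  rfl

/-- Contracting a nonzero form lowers the rank of the sets containing it by one. -/
lemma rk_insert_of_ne_zero (A : Arrangement (n + 1) d) (hA : A 0 ≠ 0)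
    {φ : (Fin e → ℂ) →ₗ[ℂ] (Fin d → ℂ)}
    (hker : LinearMap.range φ = LinearMap.ker (A 0)) (S : Finset (Fin n)) :
    A.rk (insert 0 (S.map (Fin.succEmb n))) = (A.tail.restrict φ).rk S + 1 := by
  have h1 : LinearMap.ker φ.dualMap = Submodule.span ℂ {A 0} := by
    rw [LinearMap.ker_dualMap_eq_dualAnnihilator_range, hker]
    ext m
    rw [Submodule.mem_dualAnnihilator]
    constructor
    · intro hm
      have := mem_span_of_iInf_ker_le_ker (L := fun _ : Unit => A 0) (K := m)
        (by rw [iInf_const]; exact hm)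
      rwa [Set.range_const] at this
    · intro hm x hx
      obtain ⟨c, rfl⟩ := Submodule.mem_span_singleton.1 hm
      rw [LinearMap.smul_apply, LinearMap.mem_ker.1 hx, smul_zero]
  rw [Arrangement.rk, Finset.coe_insert, Set.image_insert_eq, image_map_succ,
    finrank_eq_finrank_map_add_finrank_inf_ker φ.dualMap, h1, inf_eq_right.2,
    finrank_span_singleton hA, Submodule.map_span, Set.image_insert_eq, ← Set.image_comp]
  · have h2 : φ.dualMap (A 0) = 0 := LinearMap.range_le_ker_iff.1 hker.le
    rw [h2, Submodule.span_insert_zero]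
    rfl
  · exact Submodule.span_mono (Set.singleton_subset_iff.2 (Set.mem_insert _ _))

/-- The Tutte polynomial, evaluated and normalized so that the rank of the arrangement no longer
enters. In this form deletion and contraction behave uniformly, also for coloops. -/
noncomputable def Arrangement.subsetSum (A : Arrangement n d) : PowerSeries ℚ⸨X⸩ :=
  ∑ S : Finset (Fin n),
    q ^ (n - S.card) * (1 - q) ^ (S.card - A.rk S) * ((1 - q * z)⁻¹) ^ (d - A.rk S)

lemma sum_finset_fin_succ {R : Type*} [AddCommMonoid R] (f : Finset (Fin (n + 1)) → R) :
    ∑ S, f S = ∑ S : Finset (Fin n), f (S.map (Fin.succEmb n)) +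
      ∑ S : Finset (Fin n), f (insert 0 (S.map (Fin.succEmb n))) := by
  have h1 : (Finset.univ.map (Fin.succEmb n)).powerset =
      Finset.univ.map (Finset.mapEmbedding (Fin.succEmb n)).toEmbedding := by
    ext T
    simp only [Finset.mem_powerset, Finset.subset_map_iff, Finset.mem_map, Finset.mem_univ,
      Finset.subset_univ, true_and, RelEmbedding.coe_toEmbedding, Finset.mapEmbedding_apply,
      eq_comm]
  have h2 : (Finset.univ : Finset (Fin (n + 1))) =
      insert 0 (Finset.univ.map (Fin.succEmb n)) := by
    ext i
    refine Fin.cases ?_ (fun j => ?_) i <;> simp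
  rw [← Finset.powerset_univ, h2, Finset.sum_powerset_insert (by simp), h1, Finset.sum_map,
    Finset.sum_map]
  simp only [RelEmbedding.coe_toEmbedding, Finset.mapEmbedding_apply]

lemma card_insert_map_succ (S : Finset (Fin n)) :
    (insert 0 (S.map (Fin.succEmb n))).card = S.card + 1 := by
  rw [Finset.card_insert_of_notMem (by simp), Finset.card_map]

lemma subsetSum_of_eq_zero (A : Arrangement (n + 1) d) (hA : A 0 = 0) :
    A.subsetSum = A.tail.subsetSum := by
  rw [Arrangement.subsetSum, sum_finset_fin_succ, ← Finset.sum_add_distrib]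
  refine Finset.sum_congr rfl fun S _ => ?_
  have h1 := rk_le_card A.tail S
  have h2 : S.card ≤ n := by simpa using S.card_le_univ
  rw [rk_map_succ, rk_insert_of_eq_zero A hA, card_insert_map_succ, Finset.card_map,
    show n + 1 - S.card = n - S.card + 1 by omega, Nat.add_sub_add_right,
    show S.card + 1 - A.tail.rk S = S.card - A.tail.rk S + 1 by omega]
  ring

lemma subsetSum_of_ne_zero (A : Arrangement (n + 1) d) (hA : A 0 ≠ 0) (hed : e + 1 = d)
    {φ : (Fin e → ℂ) →ₗ[ℂ] (Fin d → ℂ)}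
    (hker : LinearMap.range φ = LinearMap.ker (A 0)) :
    A.subsetSum = q * A.tail.subsetSum + (A.tail.restrict φ).subsetSum := by
  rw [Arrangement.subsetSum, sum_finset_fin_succ, Arrangement.subsetSum, Finset.mul_sum,
    Arrangement.subsetSum]
  refine congrArg₂ (· + ·) (Finset.sum_congr rfl fun S _ => ?_) (Finset.sum_congr rfl fun S _ => ?_)
  · have h2 : S.card ≤ n := by simpa using S.card_le_univ
    rw [rk_map_succ, Finset.card_map, show n + 1 - S.card = n - S.card + 1 by omega]
    ring
  · rw [rk_insert_of_ne_zero A hA hker, card_insert_map_succ, Nat.add_sub_add_right,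
      Nat.add_sub_add_right, show d - ((A.tail.restrict φ).rk S + 1) =
        e - (A.tail.restrict φ).rk S by omega]

lemma hilbGenFun_eq_subsetSum (A : Arrangement n d) :
    A.hilbGenFun = (1 - z)⁻¹ * A.subsetSum := by
  induction n generalizing d with
  | zero =>
    have h0 : A.rk ∅ = 0 := by simp [Arrangement.rk]
    rw [hilbGenFun_empty, Arrangement.subsetSum, Fintype.sum_unique]
    change _ = _ * (q ^ (0 - (∅ : Finset (Fin 0)).card) *
      (1 - q) ^ ((∅ : Finset (Fin 0)).card - A.rk ∅) * ((1 - q * z)⁻¹) ^ (d - A.rk ∅))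
    simp [h0]
  | succ n ih =>
    by_cases hA : A 0 = 0
    · rw [hilbGenFun_of_eq_zero A hA, subsetSum_of_eq_zero A hA, ih]
    · obtain ⟨e, φ, hed, hφ, hker⟩ := exists_parametrization_ker hA
      rw [hilbGenFun_of_ne_zero A hA hφ hker, subsetSum_of_ne_zero A hA hed hker, ih, ih]
      ring

end GeneratingFunction

/-! ### The Tutte polynomial -/

section Tutte

variable {n d : ℕ}

lemma eRk_matroid (A : Arrangement n d) (S : Finset (Fin n)) :
    A.matroid.eRk (S : Set (Fin n)) = A.rk S := by
  obtain ⟨I, hI⟩ := A.matroid.exists_isBasis' (S : Set (Fin n))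
  have hind (J : Set (Fin n)) : A.matroid.Indep J ↔ LinearIndepOn ℂ A J := by
    rw [Arrangement.matroid, vectorMatroid, IndepMatroid.matroid_Indep, IndepMatroid.ofFinite_indep]
  have hIi : LinearIndepOn ℂ A I := (hind I).1 hI.indep
  have hspan : Submodule.span ℂ (A '' S) = Submodule.span ℂ (A '' I) := by
    refine le_antisymm (Submodule.span_le.2 ?_) (Submodule.span_mono (Set.image_mono hI.subset))
    rintro _ ⟨i, hi, rfl⟩
    by_contra hns
    have hi' : i ∉ I := fun h => hns (Submodule.subset_span ⟨i, h, rfl⟩)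
    exact hi' (hI.mem_of_insert_indep hi ((hind _).2 (hIi.insert hns)))
  have : Fintype I := Fintype.ofFinite I
  rw [← hI.encard_eq_eRk, Arrangement.rk, hspan, Set.image_eq_range, finrank_span_eq_card hIi,
    ← Nat.card_eq_fintype_card, Nat.card_coe_set_eq, Set.Finite.cast_ncard_eq (Set.toFinite I)]

lemma matroid_ground (A : Arrangement n d) : A.matroid.E = Set.univ := rfl

lemma rk_le_of_eRank_eq {r : ℕ} (A : Arrangement n d) (hr : A.matroid.eRank = r)
    (S : Finset (Fin n)) : A.rk S ≤ r := by
  have h := A.matroid.eRk_le_eRank S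
  rw [eRk_matroid, hr] at h
  exact_mod_cast h

lemma le_of_eRank_eq {r : ℕ} (A : Arrangement n d) (hr : A.matroid.eRank = r) : r ≤ n := by
  have h := A.matroid.eRank_le_encard_ground
  rw [hr, matroid_ground, Set.encard_univ, ENat.card_eq_coe_fintype_card, Fintype.card_fin] at h
  exact_mod_cast h

lemma aeval_tuttePoly_matroid {R : Type*} [CommRing R] [Algebra ℤ R] {r : ℕ} (A : Arrangement n d)
    (hr : A.matroid.eRank = r) (x y : R) :
    MvPolynomial.aeval ![x, y] (tuttePoly A.matroid) =
      ∑ S : Finset (Fin n), (x - 1) ^ (r - A.rk S) * (y - 1) ^ (S.card - A.rk S) := by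
  have hE : (Set.toFinite A.matroid.E).toFinset = Finset.univ := by
    ext i
    simp [matroid_ground]
  rw [tuttePoly, hE, Finset.powerset_univ, map_sum]
  refine Finset.sum_congr rfl fun S _ => ?_
  simp [hr, eRk_matroid]

lemma subsetSum_eq_tuttePoly {n r m : ℕ} (A : Arrangement n (r + m))
    (hr : A.matroid.eRank = r) :
    A.subsetSum = q ^ (n - r) * ((1 - q * z)⁻¹) ^ m *
      MvPolynomial.aeval ![1 + q * (1 - q * z)⁻¹, q⁻¹] (tuttePoly A.matroid) := by
  rw [aeval_tuttePoly_matroid A hr, Arrangement.subsetSum, Finset.mul_sum]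
  refine Finset.sum_congr rfl fun S _ => ?_
  have h1 := rk_le_card A S
  have h2 := rk_le_of_eRank_eq A hr S
  have h3 := le_of_eRank_eq A hr
  have h4 : S.card ≤ n := by simpa using S.card_le_univ
  have h5 : q⁻¹ - 1 = (1 - q) * q⁻¹ := by rw [sub_mul, q_mul_inv, one_mul]
  generalize (1 - q * z)⁻¹ = u
  -- Both sides carry `q` to the power `n - |S|`, since `(n - r) + (r - rk S) = (n - |S|) +
  -- (|S| - rk S)` and the last exponent is cancelled by the powers of `q⁻¹`.
  have h6 : q ^ (n - r) * q ^ (r - A.rk S) * (q⁻¹) ^ (S.card - A.rk S) = q ^ (n - S.card) := by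
    rw [← pow_add, show n - r + (r - A.rk S) = n - S.card + (S.card - A.rk S) by omega, pow_add,
      mul_assoc, ← mul_pow, q_mul_inv, one_pow, mul_one]
  rw [add_sub_cancel_left, h5, mul_pow, mul_pow, ← h6,
    show r + m - A.rk S = m + (r - A.rk S) by omega, pow_add]
  ring

lemma eRank_mapEquiv {α β : Type*} (M : Matroid α) (f : α ≃ β) :
    (M.mapEquiv f).eRank = M.eRank :=
  M.eRank_map f.injective.injOn

lemma tuttePoly_mapEquiv {α β : Type*} [Finite α] [Finite β] (M : Matroid α) (f : α ≃ β) :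
    tuttePoly (M.mapEquiv f) = tuttePoly M := by
  symm
  rw [tuttePoly, tuttePoly, eRank_mapEquiv]
  refine Finset.sum_equiv f.finsetCongr (fun S => ?_) fun S hS => ?_
  · simp only [Finset.mem_powerset, Set.Finite.subset_toFinset, Equiv.finsetCongr_apply,
      Finset.coe_map, Equiv.coe_toEmbedding, Matroid.mapEquiv_ground_eq]
    exact (Set.image_subset_image_iff f.injective).symm
  · have hS' : (S : Set α) ⊆ M.E := by simpa [← Finset.coe_subset] using hS
    have h : (M.mapEquiv f).eRk (f.finsetCongr S : Finset β) = M.eRk S := by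
      rw [Equiv.finsetCongr_apply, Finset.coe_map]
      exact M.eRk_map f.injective.injOn hS'
    rw [h, Equiv.finsetCongr_apply, Finset.card_map]

end Tutte

end PowerIdeal

theorem theorem4p12 {n r m : ℕ} (A : PowerIdeal.Arrangement n (r + m))
    (hr : A.matroid.eRank = (r : ℕ∞)) :
    A.hilbGenFun =
        PowerIdeal.q ^ (n - r) *
          ((1 - PowerIdeal.z)⁻¹ * ((1 - PowerIdeal.q * PowerIdeal.z)⁻¹) ^ m) *
          MvPolynomial.aeval
            ![1 + PowerIdeal.q * (1 - PowerIdeal.q * PowerIdeal.z)⁻¹, PowerIdeal.q⁻¹]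
            (PowerIdeal.tuttePoly A.matroid) ∧
      ∀ {n' r' : ℕ} (B : PowerIdeal.Arrangement n' (r' + m)),
        B.matroid.eRank = (r' : ℕ∞) →
        (∃ e : Fin n ≃ Fin n', A.matroid.mapEquiv e = B.matroid) →
        ∀ k : ℕ, PowerIdeal.hilb (A.C k) = PowerIdeal.hilb (B.C k) := by
  have key {n r : ℕ} (A : PowerIdeal.Arrangement n (r + m)) (hr : A.matroid.eRank = (r : ℕ∞)) :
      A.hilbGenFun = PowerIdeal.q ^ (n - r) *
          ((1 - PowerIdeal.z)⁻¹ * ((1 - PowerIdeal.q * PowerIdeal.z)⁻¹) ^ m) *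
          MvPolynomial.aeval
            ![1 + PowerIdeal.q * (1 - PowerIdeal.q * PowerIdeal.z)⁻¹, PowerIdeal.q⁻¹]
            (PowerIdeal.tuttePoly A.matroid) := by
    rw [PowerIdeal.hilbGenFun_eq_subsetSum, PowerIdeal.subsetSum_eq_tuttePoly A hr]
    ring
  refine ⟨key A hr, ?_⟩
  rintro n' r' B hB ⟨f, hf⟩ k
  obtain rfl : n = n' := Fin.equiv_iff_eq.1 ⟨f⟩
  obtain rfl : r = r' := by
    rw [← hf, PowerIdeal.eRank_mapEquiv, hr] at hB
    exact_mod_cast hB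
  have h : A.hilbGenFun = B.hilbGenFun := by
    rw [key A hr, key B hB, ← hf, PowerIdeal.tuttePoly_mapEquiv]
  have h1 := congrArg (PowerSeries.coeff k) h
  rw [PowerIdeal.Arrangement.hilbGenFun, PowerIdeal.Arrangement.hilbGenFun, PowerSeries.coeff_mk,
    PowerSeries.coeff_mk] at h1
  exact HahnSeries.ofPowerSeries_injective h1
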